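/- For a finite simple connected graph $G$, consider the simple random walk on $G$, which at each step moves from the current vertex to a uniformly chosen neighbour, and let $\pi(v)=\deg_G(v)/(2|E(G)|)$ be its stationary distribution. Let $m_{ij}$ denote the expected number of steps that the walk started at $i$ needs to reach $j$ for the first time (so $m_{jj}=0$). Kemeny's constant of $G$ is $\kappa(G)=\sum_{j\in V(G)} m_{ij}\,\pi(j)$, which does not depend on the vertex $i$. A Braess edge of $G$ is an unordered pair $\{u,w\}$ of distinct nonadjacent vertices of $G$ such that adding the edge $\{u,w\}$ to $G$ increases Kemeny's constant, i.e. $\kappa(G\cup\{u,w\})>\kappa(G)$; let $B(G)$ be the number of Braess edges of $G$. For integers $a\ge 1$ and $b\ge 2$, let $\mathcal S_{a,b}$ be the tree obtained from $b$ disjoint paths with $a$ vertices each by adding one new central vertex and joining it to one end-vertex of each path. Then for every integer $b\ge 2$, $B(\mathcal S_{2,b})=0$; that is, $\mathcal S_{2,b}$ has no Braess edges. -/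

import Mathlib

open scoped ENNReal

noncomputable section

/-- Transition probabilities of the simple random walk on a finite graph `G`: from `u`, the walk
moves to a neighbour of `u` chosen uniformly at random. -/
def walkProb {V : Type*} [Fintype V] (G : SimpleGraph V) (u v : V) : ℝ≥0∞ :=
  open Classical in if G.Adj u v then (G.degree u : ℝ≥0∞)⁻¹ else 0

/-- The probability `ℙ_i (T_j = n)`, where `T_j = min {t ≥ 0 | X_t = j}` is the first passage time
to `j` of the Markov chain with transition probabilities `P` started at `i`. It is the sum, over all
trajectories `x_0, …, x_n` with `x_0 = i` that reach `j` at time `n` and not before, of their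
probabilities `P x_0 x_1 * ⋯ * P x_{n-1} x_n`. -/
def firstPassageProb {V : Type*} [Fintype V] (P : V → V → ℝ≥0∞) (i j : V) (n : ℕ) : ℝ≥0∞ :=
  open Classical in
  ∑ x : Fin (n + 1) → V with
      (x 0 = i ∧ x (Fin.last n) = j ∧ ∀ t : Fin n, x t.castSucc ≠ j),
    ∏ t : Fin n, P (x t.castSucc) (x t.succ)

/-- The mean first passage time `m_{ij} = 𝔼_i [T_j]`. The second summand is the contribution
`∞ * ℙ_i (T_j = ∞)` of the event that `j` is never reached (in `ℝ≥0∞`, `∞ * 0 = 0`). -/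
def meanFirstPassage {V : Type*} [Fintype V] (P : V → V → ℝ≥0∞) (i j : V) : ℝ≥0∞ :=
  (∑' n : ℕ, (n : ℝ≥0∞) * firstPassageProb P i j n) + ⊤ * (1 - ∑' n : ℕ, firstPassageProb P i j n)

/-- The stationary distribution of the simple random walk on `G`: the probability of a vertex is its
degree divided by the sum of all degrees. See `sum_stationaryDist` and
`sum_stationaryDist_mul_walkProb`. -/
def stationaryDist {V : Type*} [Fintype V] (G : SimpleGraph V) (v : V) : ℝ≥0∞ :=
  open Classical in (G.degree v : ℝ≥0∞) / ∑ w, (G.degree w : ℝ≥0∞)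

/-- The stationary distribution has total mass one as soon as `G` has an edge. -/
theorem sum_stationaryDist {V : Type*} [Fintype V] (G : SimpleGraph V) {u v : V}
    (h : G.Adj u v) : ∑ w, stationaryDist G w = 1 := by
  classical
  have h0 : (∑ w, (G.degree w : ℝ≥0∞)) ≠ 0 := by
    intro h1
    have h2 := (Finset.sum_eq_zero_iff.1 h1) u (Finset.mem_univ u)
    have h3 : 0 < G.degree u := (G.degree_pos_iff_exists_adj u).2 ⟨v, h⟩
    exact h3.ne' (by exact_mod_cast h2)
  have ht : (∑ w, (G.degree w : ℝ≥0∞)) ≠ ⊤ := by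
    rw [← Nat.cast_sum]
    exact ENNReal.natCast_ne_top _
  simp only [stationaryDist, div_eq_mul_inv]
  rw [← Finset.sum_mul]
  convert ENNReal.mul_inv_cancel h0 ht

/-- The stationary distribution is invariant under a step of the walk. -/
theorem sum_stationaryDist_mul_walkProb {V : Type*} [Fintype V] (G : SimpleGraph V) (v : V) :
    ∑ u, stationaryDist G u * walkProb G u v = stationaryDist G v := by
  classical
  have key : ∀ u, stationaryDist G u * walkProb G u v
      = (if G.Adj v u then 1 else 0) * (∑ w, (G.degree w : ℝ≥0∞))⁻¹ := by
    intro u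
    by_cases h : G.Adj u v
    · have h3 : 0 < G.degree u := (G.degree_pos_iff_exists_adj u).2 ⟨v, h⟩
      have h4 : (G.degree u : ℝ≥0∞) ≠ 0 := by exact_mod_cast h3.ne'
      have h5 := ENNReal.mul_inv_cancel h4 (ENNReal.natCast_ne_top _)
      simp only [stationaryDist, walkProb, h, h.symm, if_true, div_eq_mul_inv]
      rw [mul_right_comm]
      congr 1
    · have h' : ¬ G.Adj v u := fun h1 => h h1.symm
      simp [walkProb, h, h']
  simp only [key]
  rw [← Finset.sum_mul, stationaryDist, div_eq_mul_inv]
  congr 1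
  rw [Finset.sum_boole, ← G.card_neighborFinset_eq_degree, G.neighborFinset_eq_filter]

/-- The sum `∑_j m_{ij} π(j)` for the simple random walk on `G` and the starting vertex `i`. -/
def kemenyFrom {V : Type*} [Fintype V] (G : SimpleGraph V) (i : V) : ℝ≥0∞ :=
  ∑ j, meanFirstPassage (walkProb G) i j * stationaryDist G j

/-- Kemeny's constant `κ(G)` of the simple random walk on `G`. For connected `G` the value does not
depend on the starting vertex, so an unspecified one is taken. -/
def kemenyConstant {V : Type*} [Fintype V] [Nonempty V] (G : SimpleGraph V) : ℝ≥0∞ :=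
  kemenyFrom G (Classical.arbitrary V)

/-- `e` is a Braess edge of `G`: a pair of distinct nonadjacent vertices such that adding the edge
`e` to `G` (strictly) increases Kemeny's constant. -/
def IsBraessEdge {V : Type*} [Fintype V] [Nonempty V] (G : SimpleGraph V) (e : Sym2 V) : Prop :=
  ¬ e.IsDiag ∧ e ∉ G.edgeSet ∧
    kemenyConstant G < kemenyConstant (G ⊔ SimpleGraph.fromEdgeSet {e})

/-- The number `B(G)` of Braess edges of `G`. -/
def numBraessEdges {V : Type*} [Fintype V] [Nonempty V] (G : SimpleGraph V) : ℕ :=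
  open Classical in (Finset.univ.filter (fun e : Sym2 V => IsBraessEdge G e)).card

/-- The spider `S_{a,b}`: the centre is `none`, and the vertex `some (i, k)` lies on the `i`-th of
the `b` legs, at distance `k + 1` from the centre, so that `some (i, a - 1)` is the end of the leg. -/
def spider (a b : ℕ) : SimpleGraph (Option (Fin b × Fin a)) :=
  SimpleGraph.fromRel fun x y =>
    match x, y with
    | none, some (_, k) => (k : ℕ) = 0
    | some (i, k), some (j, l) => i = j ∧ (k : ℕ) + 1 = l
    | _, none => False

end

/-!
Write `d_i` for the degrees of `G`, `D = ∑_i d_i`, and let `R_{ik}` be the effective resistance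
between `i` and `k`. The mean first passage times of the walk are
`m_{ij} = (D R_{ij} + ρ_j - ρ_i) / 2` with `ρ_i = ∑_k d_k R_{ik}`, so Kemeny's constant is
`∑_{i,k} d_i d_k R_{ik} / (2 D)` (`IsResistance.kemenyFrom_eq`). Only the equation
`(L R)_{ik} = c_i - 2 δ_{ik}` for the Laplacian `L` is needed for this, which serves here as the
definition of a resistance matrix: the right-hand side solves the first-step equations, it is
nonnegative by the minimum principle, and finite solutions of the first-step equations are mean
first passage times (`meanFirstPassage_eq`).

Adding an edge `uv` changes `L` by a matrix of rank one and hence replaces `R_{ik}` by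
`R_{ik} - (w_i - w_k)² / (4 (1 + R_{uv}))`, where `w_i = R_{iu} - R_{iv}` (`IsResistance.addEdge`).
So the change of Kemeny's constant can be written with the resistances of `G` alone, which gives a
criterion for `uv` not to be a Braess edge (`not_isBraessEdge`).

In the tree `spider 2 b` the resistance is the distance. Up to symmetry there are four kinds of
nonadjacent pairs: the centre and a far vertex, and two near, one near and one far, or two far
vertices on different legs. For each kind the cubic terms in the criterion cancel and leave a
quadratic inequality in `b` that holds for `b ≥ 2`.
-/

/-! ### Mean first passage times as solutions of the first-step equations -/

section FirstPassage

variable {V : Type*} [Fintype V] {P : V → V → ℝ≥0∞} {j : V}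

theorem firstPassageProb_zero (P : V → V → ℝ≥0∞) (i j : V) :
    firstPassageProb P i j 0 = open Classical in if i = j then 1 else 0 := by
  classical
  unfold firstPassageProb
  split_ifs with h
  · subst h
    rw [Finset.sum_eq_single (fun _ => i)]
    · simp
    · intro x hx hne
      refine absurd (funext fun t => ?_) hne
      have := (Finset.mem_filter.1 hx).2.1
      rw [show t = 0 from Fin.fin_one_eq_zero t, this]
    · simp
  · refine Finset.sum_eq_zero fun x hx => ?_
    obtain ⟨h1, h2, -⟩ := (Finset.mem_filter.1 hx).2
    exact absurd (h1.symm.trans h2) h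

theorem firstPassageProb_self_succ (P : V → V → ℝ≥0∞) (j : V) (n : ℕ) :
    firstPassageProb P j j (n + 1) = 0 := by
  classical
  unfold firstPassageProb
  refine Finset.sum_eq_zero fun x hx => ?_
  obtain ⟨h1, -, h3⟩ := (Finset.mem_filter.1 hx).2
  exact absurd h1 (h3 0)

/-- Conditioning on the first step: a trajectory is its first vertex followed by the shifted
trajectory. -/
theorem firstPassageProb_succ {i : V} (h : i ≠ j) (n : ℕ) :
    firstPassageProb P i j (n + 1) = ∑ k, P i k * firstPassageProb P k j n := by
  classical
  unfold firstPassageProb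
  simp only [Finset.mul_sum, Finset.sum_filter]
  rw [← (Fin.consEquiv fun _ : Fin (n + 2) => V).sum_comp, Fintype.sum_prod_type,
    Finset.sum_eq_single i, Finset.sum_comm]
  · refine Finset.sum_congr rfl fun y _ => ?_
    rw [Finset.sum_eq_single (y 0)]
    · simp only [Fin.consEquiv_apply, Fin.cons_zero, true_and, Fin.prod_univ_succ,
        Fin.forall_fin_succ, Fin.castSucc_zero, Fin.cons_succ, ← Fin.succ_castSucc,
        ← Fin.succ_last, ne_eq, h, not_false_eq_true, mul_ite, mul_zero]
    · intro k _ hk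
      simp [Ne.symm hk]
    · simp
  · intro k _ hk
    simp [hk]
  · simp

/-- The probability that a chain started at `i` has not visited `j` up to time `n`. -/
noncomputable def survivalProb (P : V → V → ℝ≥0∞) (j : V) : ℕ → V → ℝ≥0∞
  | 0, i => open Classical in if i = j then 0 else 1
  | n + 1, i => open Classical in if i = j then 0 else ∑ k, P i k * survivalProb P j n k

theorem survivalProb_eq (hP : ∀ i, ∑ k, P i k = 1) (n : ℕ) (i : V) :
    survivalProb P j n i = firstPassageProb P i j (n + 1) + survivalProb P j (n + 1) i := by
  classical
  induction n generalizing i with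
  | zero =>
    by_cases h : i = j
    · subst h; simp [survivalProb, firstPassageProb_self_succ]
    · rw [firstPassageProb_succ h]
      simp only [survivalProb, h, if_false, firstPassageProb_zero]
      rw [← Finset.sum_add_distrib]
      refine (hP i).symm.trans (Finset.sum_congr rfl fun k _ => ?_)
      split_ifs <;> simp
  | succ n ih =>
    by_cases h : i = j
    · subst h; simp [survivalProb, firstPassageProb_self_succ]
    · rw [firstPassageProb_succ h]
      conv_lhs => rw [survivalProb]
      conv_rhs => rw [survivalProb]
      simp only [h, if_false]
      rw [← Finset.sum_add_distrib]
      refine Finset.sum_congr rfl fun k _ => ?_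
      rw [ih k, mul_add]

theorem sum_firstPassageProb_add_survivalProb (hP : ∀ i, ∑ k, P i k = 1) (n : ℕ) (i : V) :
    ∑ m ∈ Finset.range (n + 1), firstPassageProb P i j m + survivalProb P j n i = 1 := by
  classical
  induction n with
  | zero =>
    simp only [zero_add, Finset.sum_range_one, firstPassageProb_zero, survivalProb]
    split_ifs <;> simp
  | succ n ih => rw [Finset.sum_range_succ, add_assoc, ← survivalProb_eq hP, ih]

/-- The expectation of `h` at time `n` on the event that `j` has not been visited before
time `n`. -/
noncomputable def killedExpectation (P : V → V → ℝ≥0∞) (j : V) (h : V → ℝ≥0∞) :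
    ℕ → V → ℝ≥0∞
  | 0, i => h i
  | n + 1, i => open Classical in if i = j then 0 else ∑ k, P i k * killedExpectation P j h n k

variable {h : V → ℝ≥0∞}

theorem killedExpectation_eq (hj : h j = 0) (hh : ∀ i, i ≠ j → h i = 1 + ∑ k, P i k * h k)
    (n : ℕ) (i : V) :
    killedExpectation P j h n i = survivalProb P j n i + killedExpectation P j h (n + 1) i := by
  classical
  induction n generalizing i with
  | zero =>
    by_cases hi : i = j
    · subst hi; simp [killedExpectation, survivalProb, hj]
    · simp [killedExpectation, survivalProb, hi, ← hh i hi]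
  | succ n ih =>
    by_cases hi : i = j
    · subst hi; simp [killedExpectation, survivalProb]
    · conv_lhs => rw [killedExpectation]
      conv_rhs => rw [killedExpectation, survivalProb]
      simp only [hi, if_false]
      rw [← Finset.sum_add_distrib]
      refine Finset.sum_congr rfl fun k _ => ?_
      rw [ih k, mul_add]

theorem killedExpectation_le (hj : h j = 0) {M : ℝ≥0∞} (hM : ∀ i, h i ≤ M) (n : ℕ) (i : V) :
    killedExpectation P j h n i ≤ M * survivalProb P j n i := by
  classical
  induction n generalizing i with
  | zero =>
    by_cases hi : i = j
    · subst hi; simp [killedExpectation, hj]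
    · simpa [killedExpectation, survivalProb, hi] using hM i
  | succ n ih =>
    by_cases hi : i = j
    · simp [killedExpectation, hi]
    · simp only [killedExpectation, survivalProb, hi, if_false, Finset.mul_sum]
      refine Finset.sum_le_sum fun k _ => ?_
      rw [mul_left_comm]
      exact mul_le_mul_right (ih k) _

theorem sum_survivalProb_add_killedExpectation (hj : h j = 0)
    (hh : ∀ i, i ≠ j → h i = 1 + ∑ k, P i k * h k) (n : ℕ) (i : V) :
    ∑ m ∈ Finset.range n, survivalProb P j m i + killedExpectation P j h n i = h i := by
  induction n with
  | zero => simp [killedExpectation]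
  | succ n ih => rw [Finset.sum_range_succ, add_assoc, ← killedExpectation_eq hj hh, ih]

/-- A finite solution `h` of the first-step equations is the mean first passage time. Truncating
at time `n` leaves the error `killedExpectation P j h n`, which is at most a constant times the
survival probability; the latter is summable with sum at most `h`, hence tends to `0`. -/
theorem meanFirstPassage_eq (hP : ∀ i, ∑ k, P i k = 1) (hj : h j = 0)
    (hh : ∀ i, i ≠ j → h i = 1 + ∑ k, P i k * h k) (hfin : ∀ i, h i ≠ ⊤) (i : V) :
    meanFirstPassage P i j = h i := by
  have hsum : ∑' n, survivalProb P j n i ≤ h i := by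
    rw [ENNReal.tsum_eq_iSup_nat]
    refine iSup_le fun n => ?_
    rw [← sum_survivalProb_add_killedExpectation hj hh n i]
    exact le_self_add
  have htend : Filter.Tendsto (fun n => survivalProb P j n i) Filter.atTop (nhds 0) :=
    ENNReal.tendsto_atTop_zero_of_tsum_ne_top (ne_top_of_le_ne_top (hfin i) hsum)
  -- The survival probabilities sum to `h i`, as the truncation error vanishes in the limit.
  have hS : ∑' n, survivalProb P j n i = h i := by
    have hM : ∀ k, h k ≤ ∑ l, h l := fun k =>
      Finset.single_le_sum (fun _ _ => zero_le) (Finset.mem_univ k)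
    have hMfin : ∑ l, h l ≠ ⊤ := ENNReal.sum_ne_top.2 fun l _ => hfin l
    have h1 : Filter.Tendsto (fun n => (∑ l, h l) * survivalProb P j n i) Filter.atTop (nhds 0) := by
      simpa using ENNReal.Tendsto.const_mul htend (Or.inr hMfin)
    have h2 : Filter.Tendsto (fun n => killedExpectation P j h n i) Filter.atTop (nhds 0) :=
      tendsto_of_tendsto_of_tendsto_of_le_of_le tendsto_const_nhds h1 (fun _ => zero_le)
        (fun n => killedExpectation_le hj hM n i)
    have h3 := (ENNReal.tendsto_nat_tsum fun n => survivalProb P j n i).add h2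
    simp only [sum_survivalProb_add_killedExpectation hj hh, add_zero] at h3
    exact tendsto_nhds_unique h3 tendsto_const_nhds
  have hF : ∀ n, ∑' m, firstPassageProb P i j (m + (n + 1)) = survivalProb P j n i := by
    intro n
    have h1 : ∀ N, ∑ m ∈ Finset.range N, firstPassageProb P i j (m + (n + 1))
        + survivalProb P j (N + n) i = survivalProb P j n i := by
      intro N
      induction N with
      | zero => simp
      | succ N ih =>
        rw [Finset.sum_range_succ, add_assoc, show N + 1 + n = (N + n) + 1 by ring,
          show N + (n + 1) = (N + n) + 1 by ring, ← survivalProb_eq hP, ih]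
    have h2 := (ENNReal.tendsto_nat_tsum fun m => firstPassageProb P i j (m + (n + 1))).add
      ((Filter.tendsto_add_atTop_iff_nat n).2 htend)
    simp only [h1, add_zero] at h2
    exact tendsto_nhds_unique h2 tendsto_const_nhds
  have hone : ∑' n, firstPassageProb P i j n = 1 := by
    rw [← sum_firstPassageProb_add_survivalProb (j := j) hP 0 i, ← hF 0,
      tsum_eq_zero_add' ENNReal.summable]
    simp
  -- Tail-sum formula for the expectation.
  have htail : ∑' n : ℕ, (n : ℝ≥0∞) * firstPassageProb P i j n
      = ∑' n, survivalProb P j n i := by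
    have h1 : ∀ m : ℕ, ∑' n, (if n < m then firstPassageProb P i j m else 0)
        = (m : ℝ≥0∞) * firstPassageProb P i j m := by
      intro m
      rw [tsum_eq_sum (s := Finset.range m) (by
        intro n hn
        exact if_neg (by simpa using hn))]
      rw [Finset.sum_congr rfl fun n hn => if_pos (Finset.mem_range.1 hn)]
      simp
    simp only [← h1]
    rw [ENNReal.tsum_comm]
    refine tsum_congr fun n => ?_
    rw [← hF n, ← ENNReal.summable.sum_add_tsum_nat_add' (k := n + 1)]
    rw [Finset.sum_eq_zero, zero_add]
    · refine tsum_congr fun m => if_pos (by omega)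
    · intro m hm
      exact if_neg (by have := Finset.mem_range.1 hm; omega)
  simp [meanFirstPassage, hone, htail, hS]

end FirstPassage

/-! ### Kemeny's constant in terms of effective resistances -/

section Resistance

variable {V : Type*} [Fintype V] {a R : V → V → ℝ}

/-- `R` is a matrix of effective resistances for the network with conductances `a`: it is symmetric
with zero diagonal, and the off-diagonal entries in each row `i` of `L R`, where `L` is the
Laplacian of the network, have a common value `c i`, which exceeds the diagonal entry by `2`. -/
structure IsResistance (a R : V → V → ℝ) : Prop where
  symm : ∀ i k, R i k = R k i
  diag : ∀ i, R i i = 0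
  laplacian : ∃ c : V → ℝ, ∀ i k,
    ∑ x, a i x * (R i k - R x k) = c i - open Classical in if i = k then 2 else 0

/-- The sum `∑_k d_k R_{ik}`, where `d_k = ∑_x a_{kx}` are the vertex weights. -/
def weightedResistance (a R : V → V → ℝ) (i : V) : ℝ := ∑ k, (∑ x, a k x) * R i k

/-- The solution of the first-step equations for the target `j`, written with resistances. -/
noncomputable def resistanceHitting (a R : V → V → ℝ) (j i : V) : ℝ :=
  ((∑ k, ∑ x, a k x) * R i j + weightedResistance a R j - weightedResistance a R i) / 2

theorem IsResistance.resistanceHitting_self (hR : IsResistance a R) (j : V) :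
    resistanceHitting a R j j = 0 := by
  simp [resistanceHitting, hR.diag]

theorem IsResistance.laplacian_resistanceHitting (hR : IsResistance a R) {i j : V} (hij : i ≠ j) :
    ∑ x, a i x * (resistanceHitting a R j i - resistanceHitting a R j x) = ∑ x, a i x := by
  classical
  obtain ⟨c, hc⟩ := hR.laplacian
  have h1 : ∑ x, a i x * (weightedResistance a R i - weightedResistance a R x)
      = (∑ k, ∑ x, a k x) * c i - 2 * ∑ x, a i x := by
    have : ∀ x, a i x * (weightedResistance a R i - weightedResistance a R x)
        = ∑ k, (∑ y, a k y) * (a i x * (R i k - R x k)) := by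
      intro x
      rw [weightedResistance, weightedResistance, ← Finset.sum_sub_distrib, Finset.mul_sum]
      exact Finset.sum_congr rfl fun k _ => by ring
    simp only [this]
    rw [Finset.sum_comm]
    simp_rw [← Finset.mul_sum, hc, mul_sub]
    rw [Finset.sum_sub_distrib, ← Finset.sum_mul]
    simp [mul_comm]
  have h2 : ∀ x, a i x * (resistanceHitting a R j i - resistanceHitting a R j x)
      = (∑ k, ∑ y, a k y) / 2 * (a i x * (R i j - R x j))
        - 1 / 2 * (a i x * (weightedResistance a R i - weightedResistance a R x)) := by
    intro x
    simp only [resistanceHitting]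
    ring
  simp only [h2]
  rw [Finset.sum_sub_distrib, ← Finset.mul_sum, ← Finset.mul_sum, h1, hc, if_neg hij]
  ring

/-- Minimum principle: at a minimum other than the target the Laplacian would be nonpositive. -/
theorem IsResistance.resistanceHitting_nonneg (hR : IsResistance a R) (ha : ∀ i x, 0 ≤ a i x)
    (hd : ∀ i, 0 < ∑ x, a i x) (j i : V) : 0 ≤ resistanceHitting a R j i := by
  obtain ⟨m, -, hm⟩ := Finset.exists_min_image Finset.univ (resistanceHitting a R j)
    ⟨j, Finset.mem_univ j⟩
  suffices m = j by
    subst this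
    simpa [hR.resistanceHitting_self] using hm i (Finset.mem_univ i)
  by_contra hne
  refine absurd (hR.laplacian_resistanceHitting hne) (ne_of_lt (lt_of_le_of_lt ?_ (hd m)))
  exact Finset.sum_nonpos fun x _ => mul_nonpos_of_nonneg_of_nonpos (ha m x)
    (sub_nonpos.2 (hm x (Finset.mem_univ x)))

/-- The adjacency matrix of `G` as a family of conductances. -/
noncomputable def conductance (G : SimpleGraph V) (i x : V) : ℝ :=
  open Classical in if G.Adj i x then 1 else 0

theorem conductance_nonneg {V : Type*} (G : SimpleGraph V) (i x : V) : 0 ≤ conductance G i x := by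
  unfold conductance
  split_ifs <;> norm_num

open Classical in
theorem sum_conductance (G : SimpleGraph V) (i : V) :
    ∑ x, conductance G i x = (G.degree i : ℝ) := by
  simp only [conductance]
  rw [Finset.sum_boole, ← G.card_neighborFinset_eq_degree, G.neighborFinset_eq_filter]

theorem walkProb_eq_ofReal (G : SimpleGraph V) (hd : ∀ i, 0 < ∑ x, conductance G i x) (i x : V) :
    walkProb G i x = ENNReal.ofReal (conductance G i x / ∑ y, conductance G i y) := by
  classical
  have h := hd i
  simp only [walkProb]
  rw [sum_conductance] at h ⊢
  simp only [conductance]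
  split_ifs
  · rw [one_div, ENNReal.ofReal_inv_of_pos h, ENNReal.ofReal_natCast]
  · simp

theorem stationaryDist_eq_ofReal (G : SimpleGraph V) (hd : ∀ i, 0 < ∑ x, conductance G i x)
    (i : V) : stationaryDist G i
      = ENNReal.ofReal ((∑ x, conductance G i x) / ∑ k, ∑ x, conductance G k x) := by
  classical
  have h : 0 < ∑ k, ∑ x, conductance G k x :=
    Finset.sum_pos (fun k _ => hd k) ⟨i, Finset.mem_univ i⟩
  rw [ENNReal.ofReal_div_of_pos h, ENNReal.ofReal_sum_of_nonneg fun k _ => (hd k).le]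
  simp only [sum_conductance, ENNReal.ofReal_natCast, stationaryDist]

theorem IsResistance.meanFirstPassage_eq {G : SimpleGraph V} (hR : IsResistance (conductance G) R)
    (hd : ∀ i, 0 < ∑ x, conductance G i x) (i j : V) :
    meanFirstPassage (walkProb G) i j
      = ENNReal.ofReal (resistanceHitting (conductance G) R j i) := by
  have hnn := hR.resistanceHitting_nonneg (conductance_nonneg G) hd j
  have hq : ∀ i x, 0 ≤ conductance G i x / ∑ y, conductance G i y := fun i x =>
    div_nonneg (conductance_nonneg G i x) (hd i).le
  refine _root_.meanFirstPassage_eq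
    (h := fun i => ENNReal.ofReal (resistanceHitting (conductance G) R j i)) ?_ ?_ ?_ ?_ i
  · intro i
    simp only [walkProb_eq_ofReal G hd]
    rw [← ENNReal.ofReal_sum_of_nonneg fun k _ => hq i k, ← Finset.sum_div, div_self (hd i).ne',
      ENNReal.ofReal_one]
  · simp [hR.resistanceHitting_self]
  · intro i hi
    have h1 := hR.laplacian_resistanceHitting hi
    simp only [walkProb_eq_ofReal G hd, ← ENNReal.ofReal_mul (hq i _)]
    rw [← ENNReal.ofReal_sum_of_nonneg fun k _ => mul_nonneg (hq i k) (hnn k),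
      ← ENNReal.ofReal_one, ← ENNReal.ofReal_add zero_le_one
        (Finset.sum_nonneg fun k _ => mul_nonneg (hq i k) (hnn k))]
    congr 1
    simp only [div_mul_eq_mul_div, ← Finset.sum_div]
    simp only [mul_sub, Finset.sum_sub_distrib, ← Finset.sum_mul] at h1
    have := (hd i).ne'
    field_simp
    linarith
  · exact fun i => ENNReal.ofReal_ne_top

/-- Kemeny's constant is `∑_{i,k} d_i d_k R_{ik} / (2 ∑_i d_i)`; in particular it does not depend
on the starting vertex. -/
theorem IsResistance.kemenyFrom_eq {G : SimpleGraph V} (hR : IsResistance (conductance G) R)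
    (hd : ∀ i, 0 < ∑ x, conductance G i x) (i : V) :
    kemenyFrom G i = ENNReal.ofReal
      ((∑ j, (∑ x, conductance G j x) * weightedResistance (conductance G) R j)
        / (2 * ∑ k, ∑ x, conductance G k x)) := by
  have hnn := fun j => hR.resistanceHitting_nonneg (conductance_nonneg G) hd j i
  have hD : 0 < ∑ k, ∑ x, conductance G k x :=
    Finset.sum_pos (fun k _ => hd k) ⟨i, Finset.mem_univ i⟩
  simp only [kemenyFrom, hR.meanFirstPassage_eq hd, stationaryDist_eq_ofReal G hd,
    ← ENNReal.ofReal_mul (hnn _)]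
  rw [← ENNReal.ofReal_sum_of_nonneg fun j _ =>
    mul_nonneg (hnn j) (div_nonneg (hd j).le hD.le)]
  congr 1
  have h1 : ∀ j, resistanceHitting (conductance G) R j i
        * ((∑ x, conductance G j x) / ∑ k, ∑ x, conductance G k x)
      = 1 / 2 * ((∑ x, conductance G j x) * R i j)
        + (∑ x, conductance G j x) * weightedResistance (conductance G) R j
          / (2 * ∑ k, ∑ x, conductance G k x)
        - (∑ x, conductance G j x) * (weightedResistance (conductance G) R i
          / (2 * ∑ k, ∑ x, conductance G k x)) := by
    intro j
    simp only [resistanceHitting]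
    field_simp
  simp only [h1]
  rw [Finset.sum_sub_distrib, Finset.sum_add_distrib, ← Finset.mul_sum, ← Finset.sum_div,
    ← Finset.sum_mul]
  change 1 / 2 * weightedResistance (conductance G) R i + _ - _ = _
  field_simp
  ring

/-! ### Adding an edge -/

/-- The conductances after an edge of conductance `1` between `u` and `v` is added. -/
noncomputable def addEdge (a : V → V → ℝ) (u v i x : V) : ℝ :=
  open Classical in a i x + (if i = u ∧ x = v then 1 else 0) + (if i = v ∧ x = u then 1 else 0)

/-- The resistances after an edge of conductance `1` between `u` and `v` is added; they differ from
the old ones by a matrix that comes from a rank-one update of the Laplacian. -/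
noncomputable def addEdgeResistance (R : V → V → ℝ) (u v i k : V) : ℝ :=
  R i k - ((R i u - R i v) - (R k u - R k v)) ^ 2 / (4 * (1 + R u v))

open Classical in
theorem sum_addEdge_mul (a : V → V → ℝ) (u v i : V) (f : V → ℝ) :
    ∑ x, addEdge a u v i x * f x
      = ∑ x, a i x * f x + (if i = u then f v else 0) + (if i = v then f u else 0) := by
  simp only [addEdge, add_mul, Finset.sum_add_distrib, ite_mul, one_mul, zero_mul, ite_and]
  congr 1
  · congr 1
    split_ifs <;> simp
  · split_ifs <;> simp

open Classical in
theorem sum_addEdge (a : V → V → ℝ) (u v i : V) :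
    ∑ x, addEdge a u v i x
      = ∑ x, a i x + (if i = u then 1 else 0) + (if i = v then 1 else 0) := by
  simpa using sum_addEdge_mul a u v i fun _ => 1

theorem sum_sum_addEdge_mul (a : V → V → ℝ) (u v : V) (f : V → ℝ) :
    ∑ i, (∑ x, addEdge a u v i x) * f i = ∑ i, (∑ x, a i x) * f i + f u + f v := by
  classical
  simp [sum_addEdge, add_mul, Finset.sum_add_distrib]

theorem conductance_sup_edge {V : Type*} (G : SimpleGraph V) {u v : V} (huv : u ≠ v)
    (hadj : ¬ G.Adj u v) :
    conductance (G ⊔ SimpleGraph.fromEdgeSet {s(u, v)}) = addEdge (conductance G) u v := by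
  classical
  ext i x
  simp only [conductance, addEdge, SimpleGraph.sup_adj, SimpleGraph.fromEdgeSet_adj,
    Set.mem_singleton_iff, Sym2.eq_iff]
  have hadj' : ¬ G.Adj v u := fun h => hadj h.symm
  by_cases h1 : i = u ∧ x = v
  · obtain ⟨rfl, rfl⟩ := h1
    simp [hadj, huv]
  · by_cases h2 : i = v ∧ x = u
    · obtain ⟨rfl, rfl⟩ := h2
      simp [hadj', huv, huv.symm]
    · simp [h1, h2]

theorem IsResistance.addEdge (hR : IsResistance a R) {u v : V} (huv : u ≠ v)
    (hr : 0 ≤ R u v) : IsResistance (addEdge a u v) (addEdgeResistance R u v) := by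
  classical
  obtain ⟨c, hc⟩ := hR.laplacian
  have hr1 : 1 + R u v ≠ 0 := by positivity
  refine ⟨fun i k => ?_, fun i => ?_, ?_⟩
  · simp only [addEdgeResistance, hR.symm i k]
    ring
  · simp [addEdgeResistance, hR.diag]
  · -- `c` changes by a multiple of the Laplacian of the square of the potential `R i u - R i v`.
    refine ⟨fun i => c i - (∑ x, a i x * ((R i u - R i v) ^ 2 - (R x u - R x v) ^ 2))
      / (4 * (1 + R u v)), fun i k => ?_⟩
    rw [sum_addEdge_mul]
    have h1 : ∀ x, a i x * (addEdgeResistance R u v i k - addEdgeResistance R u v x k)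
        = a i x * (R i k - R x k)
          - a i x * ((R i u - R i v) ^ 2 - (R x u - R x v) ^ 2) / (4 * (1 + R u v))
          + (a i x * (R i u - R x u) - a i x * (R i v - R x v))
            * ((R k u - R k v) / (2 * (1 + R u v))) := by
      intro x
      simp only [addEdgeResistance]
      field_simp
      ring
    simp only [h1]
    rw [Finset.sum_add_distrib, Finset.sum_sub_distrib, ← Finset.sum_div, ← Finset.sum_mul,
      Finset.sum_sub_distrib, hc, hc, hc]
    have hvu := hR.symm v u
    have hku := hR.symm k u
    have hkv := hR.symm k v
    have hu := hR.diag u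
    have hv := hR.diag v
    by_cases hiu : i = u
    · subst hiu
      simp only [huv, if_true, if_false, addEdgeResistance, hvu, hku, hkv, hu, hv]
      field_simp
      ring
    · by_cases hiv : i = v
      · subst hiv
        simp only [hiu, if_true, if_false, addEdgeResistance, hvu, hku, hkv, hu, hv]
        field_simp
        ring
      · simp only [hiu, hiv, if_false]
        ring

/-- The quadratic form `∑_{i,k} d_i d_k R_{ik}` after adding an edge. -/
theorem sum_mul_weightedResistance_addEdge (hR : IsResistance a R) (u v : V) (hr : 0 ≤ R u v) :
    ∑ i, (∑ x, _root_.addEdge a u v i x)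
        * weightedResistance (_root_.addEdge a u v) (addEdgeResistance R u v) i
      = ∑ i, (∑ x, a i x) * weightedResistance a R i
        + 2 * (weightedResistance a R u + weightedResistance a R v + R u v)
        - ((∑ i, ∑ x, a i x + 2) * (∑ i, (∑ x, a i x) * (R i u - R i v) ^ 2 + 2 * R u v ^ 2)
          - (weightedResistance a R u - weightedResistance a R v) ^ 2) / (2 * (1 + R u v)) := by
  have hr1 : 1 + R u v ≠ 0 := by positivity
  set D := ∑ i, ∑ x, a i x with hD
  set Q := ∑ i, (∑ x, a i x) * (R i u - R i v) ^ 2 with hQ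
  set ρ := weightedResistance a R with hρ
  have hL : ∑ i, (∑ x, a i x) * (R i u - R i v) = ρ u - ρ v := by
    simp only [hρ, weightedResistance, mul_sub, Finset.sum_sub_distrib, hR.symm u, hR.symm v]
  have h1 : ∀ i, weightedResistance (_root_.addEdge a u v) (addEdgeResistance R u v) i
      = ρ i + R i u + R i v - ((D + 2) * (R i u - R i v) ^ 2
          - 2 * (ρ u - ρ v) * (R i u - R i v) + (Q + 2 * R u v ^ 2)) / (4 * (1 + R u v)) := by
    intro i
    rw [weightedResistance, sum_sum_addEdge_mul]
    have h2 : ∀ k, (∑ x, a k x) * addEdgeResistance R u v i k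
        = (∑ x, a k x) * R i k - ((∑ x, a k x) * (R i u - R i v) ^ 2
          - (∑ x, a k x) * (R k u - R k v) * (2 * (R i u - R i v))
          + (∑ x, a k x) * (R k u - R k v) ^ 2) / (4 * (1 + R u v)) := by
      intro k
      simp only [addEdgeResistance]
      ring
    simp only [h2]
    rw [Finset.sum_sub_distrib, ← Finset.sum_div, Finset.sum_add_distrib, Finset.sum_sub_distrib,
      ← Finset.sum_mul, ← Finset.sum_mul, hL]
    change ρ i - _ + _ + _ = _
    simp only [addEdgeResistance, hR.diag, hR.symm v u]
    field_simp
    ring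
  rw [sum_sum_addEdge_mul]
  simp only [h1]
  have h3 : ∀ i, (∑ x, a i x) * (ρ i + R i u + R i v - ((D + 2) * (R i u - R i v) ^ 2
          - 2 * (ρ u - ρ v) * (R i u - R i v) + (Q + 2 * R u v ^ 2)) / (4 * (1 + R u v)))
      = (∑ x, a i x) * ρ i + (∑ x, a i x) * R u i + (∑ x, a i x) * R v i
        - ((D + 2) * ((∑ x, a i x) * (R i u - R i v) ^ 2)
          - 2 * (ρ u - ρ v) * ((∑ x, a i x) * (R i u - R i v))
          + (∑ x, a i x) * (Q + 2 * R u v ^ 2)) / (4 * (1 + R u v)) := by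
    intro i
    rw [hR.symm u i, hR.symm v i]
    ring
  simp only [h3]
  rw [Finset.sum_sub_distrib, ← Finset.sum_div, Finset.sum_add_distrib, Finset.sum_add_distrib,
    Finset.sum_add_distrib, Finset.sum_sub_distrib, ← Finset.mul_sum, ← Finset.mul_sum,
    ← Finset.sum_mul, hL]
  change _ + ρ u + ρ v - _ + _ + _ = _
  simp only [hR.diag, hR.symm v u]
  field_simp
  ring

/-- A sufficient condition, in terms of the resistances of `G` only, for `{u, v}` not to be a Braess
edge; it says that the value of Kemeny's constant given by `IsResistance.kemenyFrom_eq` does not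
increase. In `hle` the denominators `2 * D`, `2 * (D + 2)` and `2 * (1 + r)` are cleared and the
terms with `D * S` cancelled. -/
theorem not_isBraessEdge [Nonempty V] {G : SimpleGraph V} (hR : IsResistance (conductance G) R)
    (hd : ∀ i, 0 < ∑ x, conductance G i x) {u v : V} (hr : 0 ≤ R u v) {D S Q ρu ρv r : ℝ}
    (hD : ∑ i, ∑ x, conductance G i x = D)
    (hS : ∑ i, (∑ x, conductance G i x) * weightedResistance (conductance G) R i = S)
    (hQ : ∑ i, (∑ x, conductance G i x) * (R i u - R i v) ^ 2 = Q)
    (hρu : weightedResistance (conductance G) R u = ρu)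
    (hρv : weightedResistance (conductance G) R v = ρv) (hrr : R u v = r)
    (hle : D * (2 * (ρu + ρv + r) * (2 * (1 + r)) - ((D + 2) * (Q + 2 * r ^ 2) - (ρu - ρv) ^ 2))
      ≤ 2 * S * (2 * (1 + r))) :
    ¬ IsBraessEdge G s(u, v) := by
  classical
  rintro ⟨h1, h2, h3⟩
  have huv : u ≠ v := by simpa using h1
  have hadj : ¬ G.Adj u v := by simpa using h2
  have hR' := hR.addEdge huv hr
  have hd' : ∀ i, 0 < ∑ x, addEdge (conductance G) u v i x := by
    intro i
    rw [sum_addEdge]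
    have := hd i
    positivity
  rw [← conductance_sup_edge G huv hadj] at hR' hd'
  refine absurd h3 (not_lt.2 ?_)
  rw [kemenyConstant, kemenyConstant, hR.kemenyFrom_eq hd, hR'.kemenyFrom_eq hd',
    conductance_sup_edge G huv hadj, sum_mul_weightedResistance_addEdge hR u v hr]
  have hD' : ∑ i, ∑ x, addEdge (conductance G) u v i x = D + 2 := by
    have := sum_sum_addEdge_mul (conductance G) u v fun _ => 1
    simp only [mul_one] at this
    rw [this, hD]
    ring
  have hD0 : 0 < D := hD ▸ Finset.sum_pos (fun k _ => hd k) ⟨u, Finset.mem_univ u⟩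
  rw [hD', hD, hS, hQ, hρu, hρv]
  rw [hrr] at hr ⊢
  refine ENNReal.ofReal_le_ofReal ?_
  rw [div_le_div_iff₀ (by positivity) (by positivity)]
  have hr1 : 0 < 2 * (1 + r) := by positivity
  refine le_of_mul_le_mul_right ?_ hr1
  have : (((D + 2) * (Q + 2 * r ^ 2) - (ρu - ρv) ^ 2) / (2 * (1 + r))) * (2 * (1 + r))
      = (D + 2) * (Q + 2 * r ^ 2) - (ρu - ρv) ^ 2 := div_mul_cancel₀ _ hr1.ne'
  linear_combination 2 * hle - 2 * D * this

end Resistance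

/-! ### The spider with legs of length two -/

section Spider

variable {b : ℕ}

/-- The distance between two vertices of `spider 2 b`, which is the effective resistance between
them because the spider is a tree. -/
noncomputable def spiderDist : Option (Fin b × Fin 2) → Option (Fin b × Fin 2) → ℝ
  | none, none => 0
  | none, some (_, l) => l + 1
  | some (_, k), none => k + 1
  | some (i, k), some (j, l) => if i = j then |(k : ℝ) - l| else k + l + 2

theorem sum_spider (f : Option (Fin b × Fin 2) → ℝ) :
    ∑ x, f x = f none + ∑ p, (f (some (p, 0)) + f (some (p, 1))) := by
  simp [Fintype.sum_option, Fintype.sum_prod_type]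

theorem spider_sum_conductance_none (f : Option (Fin b × Fin 2) → ℝ) :
    ∑ x, conductance (spider 2 b) none x * f x = ∑ p, f (some (p, 0)) := by
  rw [sum_spider]
  simp [conductance, spider]

theorem spider_sum_conductance_near (p : Fin b) (f : Option (Fin b × Fin 2) → ℝ) :
    ∑ x, conductance (spider 2 b) (some (p, 0)) x * f x = f none + f (some (p, 1)) := by
  rw [sum_spider]
  simp [conductance, spider]

theorem spider_sum_conductance_far (p : Fin b) (f : Option (Fin b × Fin 2) → ℝ) :
    ∑ x, conductance (spider 2 b) (some (p, 1)) x * f x = f (some (p, 0)) := by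
  rw [sum_spider]
  simp [conductance, spider]

theorem spider_degree_none : ∑ x, conductance (spider 2 b) none x = b := by
  simpa using spider_sum_conductance_none (b := b) fun _ => 1

theorem spider_degree_near (p : Fin b) : ∑ x, conductance (spider 2 b) (some (p, 0)) x = 2 := by
  simpa [one_add_one_eq_two] using spider_sum_conductance_near p fun _ => 1

theorem spider_degree_far (p : Fin b) : ∑ x, conductance (spider 2 b) (some (p, 1)) x = 1 := by
  simpa using spider_sum_conductance_far p fun _ => 1

theorem spider_degree_pos (hb : 2 ≤ b) (i : Option (Fin b × Fin 2)) :
    0 < ∑ x, conductance (spider 2 b) i x := by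
  match i with
  | none => rw [spider_degree_none]; exact_mod_cast (by omega : 0 < b)
  | some (p, 0) => rw [spider_degree_near]; norm_num
  | some (p, 1) => rw [spider_degree_far]; norm_num

theorem spider_sum_degree_mul (f : Option (Fin b × Fin 2) → ℝ) :
    ∑ i, (∑ x, conductance (spider 2 b) i x) * f i
      = b * f none + ∑ p, (2 * f (some (p, 0)) + f (some (p, 1))) := by
  simp only [sum_spider fun i => (∑ x, conductance (spider 2 b) i x) * f i, spider_degree_none,
    spider_degree_near, spider_degree_far, one_mul]

/-- Used for sums over the legs: `γ` is the contribution of a leg without a distinguished vertex. -/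
theorem sum_fin_eq_of_ne (p : Fin b) {f : Fin b → ℝ} {γ : ℝ} (h : ∀ x, x ≠ p → f x = γ) :
    ∑ x, f x = f p + (b - 1) * γ := by
  have : ∀ x, f x = γ + if x = p then f p - γ else 0 := by
    intro x
    by_cases hx : x = p
    · simp [hx]
    · simp [hx, h x hx]
  rw [Finset.sum_congr rfl fun x _ => this x]
  simp only [Finset.sum_add_distrib, Finset.sum_const, Finset.card_univ, Fintype.card_fin,
    nsmul_eq_mul, Finset.sum_ite_eq', Finset.mem_univ, if_true]
  ring

theorem sum_fin_eq_of_ne_of_ne {p q : Fin b} (hpq : p ≠ q) {f : Fin b → ℝ} {γ : ℝ}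
    (h : ∀ x, x ≠ p → x ≠ q → f x = γ) : ∑ x, f x = f p + f q + (b - 2) * γ := by
  have : ∀ x, f x = γ + (if x = p then f p - γ else 0) + if x = q then f q - γ else 0 := by
    intro x
    by_cases hx : x = p
    · subst hx; simp [hpq]
    · by_cases hx' : x = q
      · simp [hx', hpq.symm]
      · simp [hx, hx', h x hx hx']
  rw [Finset.sum_congr rfl fun x _ => this x]
  simp only [Finset.sum_add_distrib, Finset.sum_const, Finset.card_univ, Fintype.card_fin,
    nsmul_eq_mul, Finset.sum_ite_eq', Finset.mem_univ, if_true]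
  ring

theorem spiderDist_comm (x y : Option (Fin b × Fin 2)) : spiderDist x y = spiderDist y x := by
  match x, y with
  | none, none => rfl
  | none, some _ => rfl
  | some _, none => rfl
  | some (i, k), some (j, l) =>
    simp only [spiderDist, eq_comm (a := i), abs_sub_comm (k : ℝ), add_comm (k : ℝ)]

theorem spiderDist_nonneg (x y : Option (Fin b × Fin 2)) : 0 ≤ spiderDist x y := by
  match x, y with
  | none, none => exact le_rfl
  | none, some _ => simp only [spiderDist]; positivity
  | some _, none => simp only [spiderDist]; positivity
  | some (i, k), some (j, l) =>
    simp only [spiderDist]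
    split_ifs <;> positivity

/-- In a tree the off-diagonal part of the Laplacian of the distance is `2 - d_i`: all neighbours of
`i` but one are further away from the other vertex. -/
theorem isResistance_spiderDist : IsResistance (conductance (spider 2 b)) spiderDist := by
  classical
  refine ⟨spiderDist_comm, fun i => ?_, fun i => 2 - ∑ x, conductance (spider 2 b) i x,
    fun i k => ?_⟩
  · match i with
    | none => rfl
    | some (i, k) => simp [spiderDist]
  · beta_reduce
    match i, k with
    | none, none =>
      rw [spider_sum_conductance_none, spider_degree_none]; simp [spiderDist]
    | none, some (q, l) =>
      rw [spider_sum_conductance_none, spider_degree_none, sum_fin_eq_of_ne q (γ := -1)]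
      · fin_cases l <;> simp [spiderDist] <;> ring
      · intro x hx
        simp [spiderDist, hx]
        ring
    | some (p, 0), none =>
      rw [spider_sum_conductance_near, spider_degree_near]; simp [spiderDist]
    | some (p, 1), none =>
      rw [spider_sum_conductance_far, spider_degree_far]; simp [spiderDist]; norm_num
    | some (p, 0), some (q, l) =>
      rw [spider_sum_conductance_near, spider_degree_near]
      by_cases h : p = q <;> fin_cases l <;> simp [spiderDist, h] <;> norm_num
    | some (p, 1), some (q, l) =>
      rw [spider_sum_conductance_far, spider_degree_far]
      by_cases h : p = q <;> fin_cases l <;> simp [spiderDist, h] <;> norm_num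

theorem spider_weightedResistance_none :
    weightedResistance (conductance (spider 2 b)) spiderDist none = 4 * b := by
  rw [weightedResistance, spider_sum_degree_mul]
  simp [spiderDist]
  ring

theorem spider_weightedResistance_near (p : Fin b) :
    weightedResistance (conductance (spider 2 b)) spiderDist (some (p, 0)) = 8 * b - 6 := by
  rw [weightedResistance, spider_sum_degree_mul, sum_fin_eq_of_ne p (γ := 7)]
  · simp [spiderDist]
    ring
  · intro x hx
    simp [spiderDist, hx.symm]
    norm_num

theorem spider_weightedResistance_far (p : Fin b) :
    weightedResistance (conductance (spider 2 b)) spiderDist (some (p, 1)) = 12 * b - 8 := by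
  rw [weightedResistance, spider_sum_degree_mul, sum_fin_eq_of_ne p (γ := 10)]
  · simp [spiderDist]
    ring
  · intro x hx
    simp [spiderDist, hx.symm]
    norm_num

theorem spider_sum_sum_conductance : ∑ i, ∑ x, conductance (spider 2 b) i x = 4 * b := by
  have := spider_sum_degree_mul (b := b) fun _ => 1
  simp only [mul_one] at this
  rw [this]
  simp
  ring

theorem spider_sum_degree_mul_weightedResistance :
    ∑ i, (∑ x, conductance (spider 2 b) i x)
        * weightedResistance (conductance (spider 2 b)) spiderDist i = 32 * b ^ 2 - 20 * b := by
  rw [spider_sum_degree_mul]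
  simp only [spider_weightedResistance_none, spider_weightedResistance_near,
    spider_weightedResistance_far, Finset.sum_const, Finset.card_univ, Fintype.card_fin, nsmul_eq_mul]
  ring

theorem spider_not_isBraessEdge_none_far (hb : 2 ≤ b) (p : Fin b) :
    ¬ IsBraessEdge (spider 2 b) s(none, some (p, 1)) := by
  have hb' : (2 : ℝ) ≤ b := by exact_mod_cast hb
  refine not_isBraessEdge (r := 2) (Q := 16 * b - 8) isResistance_spiderDist (spider_degree_pos hb)
    (spiderDist_nonneg _ _) spider_sum_sum_conductance spider_sum_degree_mul_weightedResistance ?_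
    spider_weightedResistance_none (spider_weightedResistance_far p) ?_ ?_
  · rw [spider_sum_degree_mul, sum_fin_eq_of_ne p (γ := 12)]
    · simp [spiderDist]
      ring
    · intro x hx
      simp [spiderDist, hx]
      norm_num
  · simp [spiderDist]; norm_num
  · nlinarith

theorem spider_not_isBraessEdge_near_near (hb : 2 ≤ b) {p q : Fin b} (hpq : p ≠ q) :
    ¬ IsBraessEdge (spider 2 b) s(some (p, 0), some (q, 0)) := by
  have hb' : (2 : ℝ) ≤ b := by exact_mod_cast hb
  refine not_isBraessEdge (r := 2) (Q := 24) isResistance_spiderDist (spider_degree_pos hb)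
    (spiderDist_nonneg _ _) spider_sum_sum_conductance spider_sum_degree_mul_weightedResistance ?_
    (spider_weightedResistance_near p) (spider_weightedResistance_near q) ?_ ?_
  · rw [spider_sum_degree_mul, sum_fin_eq_of_ne_of_ne hpq (γ := 0)]
    · simp [spiderDist, hpq, hpq.symm]
      norm_num
    · intro x hx hx'
      simp [spiderDist, hx, hx']
  · simp [spiderDist, hpq]
  · nlinarith

theorem spider_not_isBraessEdge_near_far (hb : 2 ≤ b) {p q : Fin b} (hpq : p ≠ q) :
    ¬ IsBraessEdge (spider 2 b) s(some (p, 0), some (q, 1)) := by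
  have hb' : (2 : ℝ) ≤ b := by exact_mod_cast hb
  refine not_isBraessEdge (r := 3) (Q := 4 * b + 32) isResistance_spiderDist (spider_degree_pos hb)
    (spiderDist_nonneg _ _) spider_sum_sum_conductance spider_sum_degree_mul_weightedResistance ?_
    (spider_weightedResistance_near p) (spider_weightedResistance_far q) ?_ ?_
  · rw [spider_sum_degree_mul, sum_fin_eq_of_ne_of_ne hpq (γ := 3)]
    · simp [spiderDist, hpq, hpq.symm]
      ring
    · intro x hx hx'
      simp [spiderDist, hx, hx']
      norm_num
  · simp [spiderDist, hpq]; norm_num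
  · nlinarith

theorem spider_not_isBraessEdge_far_far (hb : 2 ≤ b) {p q : Fin b} (hpq : p ≠ q) :
    ¬ IsBraessEdge (spider 2 b) s(some (p, 1), some (q, 1)) := by
  have hb' : (2 : ℝ) ≤ b := by exact_mod_cast hb
  refine not_isBraessEdge (r := 4) (Q := 48) isResistance_spiderDist (spider_degree_pos hb)
    (spiderDist_nonneg _ _) spider_sum_sum_conductance spider_sum_degree_mul_weightedResistance ?_
    (spider_weightedResistance_far p) (spider_weightedResistance_far q) ?_ ?_
  · rw [spider_sum_degree_mul, sum_fin_eq_of_ne_of_ne hpq (γ := 0)]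
    · simp [spiderDist, hpq, hpq.symm]
      norm_num
    · intro x hx hx'
      simp [spiderDist, hx, hx']
  · simp [spiderDist, hpq]; norm_num
  · nlinarith

theorem spider_adj_none_near (p : Fin b) : (spider 2 b).Adj none (some (p, 0)) := by
  simp [spider]

theorem spider_adj_near_far (p : Fin b) : (spider 2 b).Adj (some (p, 0)) (some (p, 1)) := by
  simp [spider]

theorem corollary4p5 (b : ℕ) (hb : 2 ≤ b) : numBraessEdges (spider 2 b) = 0 := by
  classical
  have hadj : ∀ {x y : Option (Fin b × Fin 2)}, (spider 2 b).Adj x y →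
      ¬ IsBraessEdge (spider 2 b) s(x, y) := fun h hB => hB.2.1 h
  rw [numBraessEdges, Finset.card_eq_zero, Finset.filter_eq_empty_iff]
  rintro e -
  induction e using Sym2.ind with
  | _ x y =>
    match x, y with
    | none, none => exact fun h => h.1 rfl
    | none, some (p, k) =>
      match k with
      | 0 => exact hadj (spider_adj_none_near p)
      | 1 => exact spider_not_isBraessEdge_none_far hb p
    | some (p, k), none =>
      match k with
      | 0 => exact hadj (spider_adj_none_near p).symm
      | 1 => exact Sym2.eq_swap ▸ spider_not_isBraessEdge_none_far hb p
    | some (p, k), some (q, l) =>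
      by_cases hpq : p = q
      · subst hpq
        match k, l with
        | 0, 0 => exact fun h => h.1 rfl
        | 0, 1 => exact hadj (spider_adj_near_far p)
        | 1, 0 => exact hadj (spider_adj_near_far p).symm
        | 1, 1 => exact fun h => h.1 rfl
      · match k, l with
        | 0, 0 => exact spider_not_isBraessEdge_near_near hb hpq
        | 0, 1 => exact spider_not_isBraessEdge_near_far hb hpq
        | 1, 0 => exact Sym2.eq_swap ▸ spider_not_isBraessEdge_near_far hb (Ne.symm hpq)
        | 1, 1 => exact spider_not_isBraessEdge_far_far hb hpq

end Spider
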